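/- Let $n\ge 1$ and $[n]=\{1,\dots,n\}$; all graphs are simple. Let $\mathsf{Cycle}_n$ be the cycle graph on $[n]$, in which $i$ and $i+1$ (mod $n$) are adjacent (a single vertex for $n=1$, a single edge for $n=2$). For a graph $Y$ on $[n]$, let $\mathsf{FS}(\mathsf{Cycle}_n,Y)$ be the graph whose vertices are the permutations of $[n]$, where $\sigma$ and $\sigma'$ are adjacent if and only if $\sigma'=\sigma\circ(a\,b)$ for some edge $\{a,b\}$ of $\mathsf{Cycle}_n$ such that $\{\sigma(a),\sigma(b)\}$ is an edge of $Y$. Let $\varphi(i)=i+1 \pmod n$ and $\varphi^*(\sigma)=\sigma\circ\varphi$; for an induced subgraph $H$ of $\mathsf{FS}(\mathsf{Cycle}_n,Y)$, let $\varphi^*(H)$ be the induced subgraph of $\mathsf{FS}(\mathsf{Cycle}_n,Y)$ on the vertex set $\varphi^*(V(H))$. A flip of an acyclic orientation of the complement $\overline Y$ reverses all edges at a vertex that is a source or a sink. Two acyclic orientations are torically equivalent, written $\alpha\sim\alpha'$, if one is obtained from the other by a sequence of flips; the equivalence classes $[\alpha]_\sim\in\operatorname{Acyc}(\overline Y)/\!\sim$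 are the toric acyclic orientations of $\overline Y$. A linear extension of $[\alpha]_\sim$ is a permutation $\sigma$ for which there is some $\widehat\alpha\in[\alpha]_\sim$ such that $\sigma^{-1}(i)\le\sigma^{-1}(j)$ whenever $\widehat\alpha$ has a directed path from $i$ to $j$. **Theorem.** Let $Y$ be a graph on the vertex set $[n]$. Let $n_1,\dots,n_r$ be the sizes of the connected components of $\overline Y$, and let $\nu=\gcd(n_1,\dots,n_r)$. For each toric acyclic orientation $[\alpha]_\sim$ of $\overline Y$, choose a linear extension $\sigma_{[\alpha]_\sim}$ of $[\alpha]_\sim$, and let $J_{[\alpha]_\sim}$ be the connected component of $\mathsf{FS}(\mathsf{Cycle}_n,Y)$ containing $\sigma_{[\alpha]_\sim}$. Then, for each $[\alpha]_\sim$, the graphs $$J_{[\alpha]_\sim},\ \varphi^*(J_{[\alpha]_\sim}),\ \dots,\ (\varphi^*)^{\nu-1}(J_{[\alpha]_\sim})$$ are distinct, pairwise isomorphic connected components of $\mathsf{FS}(\mathsf{Cycle}_n,Y)$. Moreover, $\mathsf{FS}(\mathsf{Cycle}_n,Y)$ is the disjoint union $$\mathsf{FS}(\mathsf{Cycle}_n,Y)=\bigoplus_{[\alpha]_\sim\in\operatorname{Acyc}(\overline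 Y)/\sim}\ \bigoplus_{k=0}^{\nu-1}(\varphi^*)^k(J_{[\alpha]_\sim}).$$ -/

import Mathlib

/-- The friends-and-strangers graph of `X` and `Y`: its vertices are the bijections
`V(X) → V(Y)`, and its edges are the friendly swaps. -/
def FS {V W : Type*} (X : SimpleGraph V) (Y : SimpleGraph W) : SimpleGraph (V ≃ W) where
  Adj σ τ := ∃ a b : V, X.Adj a b ∧ Y.Adj (σ a) (σ b) ∧ σ a = τ b ∧ σ b = τ a ∧
    ∀ c : V, c ≠ a → c ≠ b → σ c = τ c
  symm := ⟨by
    rintro σ τ ⟨a, b, hX, hY, h1, h2, h3⟩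
    exact ⟨a, b, hX, by rw [← h1, ← h2]; exact hY.symm, h2.symm, h1.symm,
      fun c ha hb => (h3 c ha hb).symm⟩⟩
  loopless := ⟨by
    rintro σ ⟨a, b, hX, hY, h1, h2, h3⟩
    exact hX.ne (σ.injective h1)⟩

/-- An acyclic orientation of `G`; `dir a b` says that `{a, b}` is an edge of `G`
which is directed from `a` to `b`. -/
@[ext]
structure AcyclicOrientation {V : Type*} (G : SimpleGraph V) where
  dir : V → V → Prop
  adj_iff : ∀ a b, G.Adj a b ↔ dir a b ∨ dir b a
  asymm : ∀ a b, dir a b → ¬ dir b a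
  acyclic : ∀ a, ¬ Relation.TransGen dir a a

namespace AcyclicOrientation

variable {V : Type*} {G : SimpleGraph V}

/-- A vertex of in-degree `0`. -/
def IsSource (α : AcyclicOrientation G) (v : V) : Prop := ∀ u, ¬ α.dir u v

/-- A vertex of out-degree `0`. -/
def IsSink (α : AcyclicOrientation G) (v : V) : Prop := ∀ u, ¬ α.dir v u

/-- `β` is obtained from `α` by a flip: the directions of all edges at some vertex `v`, which is
a source or a sink of `α`, are reversed, and all other edges keep their directions. -/
def IsFlip (α β : AcyclicOrientation G) : Prop :=
  ∃ v, (α.IsSource v ∨ α.IsSink v) ∧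
    (∀ a b, (a = v ∨ b = v) → (β.dir a b ↔ α.dir b a)) ∧
    (∀ a b, a ≠ v → b ≠ v → (β.dir a b ↔ α.dir a b))

theorem IsFlip.symm {α β : AcyclicOrientation G} (h : IsFlip α β) : IsFlip β α := by
  obtain ⟨v, hv, h1, h2⟩ := h
  refine ⟨v, ?_, fun a b hab => (h1 b a hab.symm).symm, fun a b ha hb => (h2 a b ha hb).symm⟩
  rcases hv with hv | hv
  · exact Or.inr fun u hu => hv u ((h1 v u (Or.inl rfl)).1 hu)
  · exact Or.inl fun u hu => hv u ((h1 u v (Or.inr rfl)).1 hu)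

/-- Toric equivalence: `β` is obtained from `α` by a (possibly empty) sequence of flips. -/
def ToricEquiv (α β : AcyclicOrientation G) : Prop := Relation.ReflTransGen IsFlip α β

theorem toricEquiv_equivalence : Equivalence (ToricEquiv (G := G)) where
  refl _ := Relation.ReflTransGen.refl
  symm h := by
    induction h with
    | refl => exact Relation.ReflTransGen.refl
    | tail _ hbc ih => exact Relation.ReflTransGen.head hbc.symm ih
  trans h h' := Relation.ReflTransGen.trans h h'

/-- Toric equivalence as a setoid. -/
def toricSetoid (G : SimpleGraph V) : Setoid (AcyclicOrientation G) where
  r := ToricEquiv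
  iseqv := toricEquiv_equivalence

/-- `σ` is a linear extension of the poset on the vertices of `G` in which `a ≤ b` iff there is
a directed path from `a` to `b` in `α`; here `σ i` is the vertex at position `i`. -/
def IsLinearExtension {n : ℕ} (α : AcyclicOrientation G) (σ : Fin n ≃ V) : Prop :=
  ∀ a b, Relation.ReflTransGen α.dir a b → σ.symm a ≤ σ.symm b

end AcyclicOrientation

/-- Toric acyclic orientations of `G`: the toric equivalence classes of acyclic orientations. -/
def ToricAcyclicOrientation {V : Type*} (G : SimpleGraph V) : Type _ :=
  Quotient (AcyclicOrientation.toricSetoid G)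

/-- `σ` is a linear extension of some acyclic orientation in the class `t`. -/
def ToricAcyclicOrientation.IsLinearExtension {V : Type*} {G : SimpleGraph V} {n : ℕ}
    (t : ToricAcyclicOrientation G) (σ : Fin n ≃ V) : Prop :=
  ∃ α : AcyclicOrientation G,
    Quotient.mk (AcyclicOrientation.toricSetoid G) α = t ∧ α.IsLinearExtension σ

open Classical in
/-- The greatest common divisor of the sizes of the connected components of `G`. -/
noncomputable def componentGcd {V : Type*} [Finite V] (G : SimpleGraph V) : ℕ :=
  letI : Fintype G.ConnectedComponent := Fintype.ofFinite _
  Finset.univ.gcd fun c : G.ConnectedComponent => c.supp.ncard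

/-- The map `σ ↦ σ ∘ φ`, where `φ` is the rotation `i ↦ i + 1` modulo `n`. -/
def phiStar {n : ℕ} (σ : Fin n ≃ Fin n) : Fin n ≃ Fin n := (finRotate n).trans σ

/-- For a subgraph `H` of `FS(Cycle_n, Y)`, the induced subgraph of `FS(Cycle_n, Y)` on the image
of the vertex set of `H` under `σ ↦ σ ∘ φ`. -/
def phiStarSubgraph {n : ℕ} (Y : SimpleGraph (Fin n))
    (H : (FS (SimpleGraph.cycleGraph n) Y).Subgraph) :
    (FS (SimpleGraph.cycleGraph n) Y).Subgraph :=
  (⊤ : (FS (SimpleGraph.cycleGraph n) Y).Subgraph).induce (phiStar '' H.verts)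

/-- The connected component of `G` containing the vertex `v`, as a subgraph of `G`. -/
def componentAt {V : Type*} (G : SimpleGraph V) (v : V) : G.Subgraph :=
  (G.connectedComponentMk v).toSubgraph

/-- `G` is the (internal) disjoint union of the subgraphs `H i`: the vertex sets of the `H i` are
pairwise disjoint, and together the `H i` contain all vertices and all edges of `G`. -/
def IsDisjointUnion {V ι : Type*} (G : SimpleGraph V) (H : ι → G.Subgraph) : Prop :=
  (Pairwise fun i j => Disjoint (H i).verts (H j).verts) ∧ (⨆ i, H i) = ⊤

/-! Each permutation `σ` orients the complement of `Y` by position (`ofPerm`). A friendly swap of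
positions i, i+1 keeps this orientation, and permutations with the same orientation are joined by
such swaps (`reachable_of_ofPerm_eq`), so a component of the graph depends only on the orientations
it realizes. Rotation sends the first entry to the end, turning a source into a sink; conversely, a
source flip applies φ* to the component. Hence the φ*-orbits of components correspond to the toric
classes.

It remains to show that each orbit has length ν. Moving all vertices of one component of the
complement once around the circle restores the orientation, so the size of that component is a
period (`isPeriodicPt_ncard`). For the other divisibility, record how often each vertex winds around
the circle (`IsWinding`): swaps contribute total 0 and each rotation contributes -1. If the
orientation returns to itself, the winding is constant on components of the complement, so its total
is a multiple of ν. -/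

theorem finRotate_val {n : ℕ} (i : Fin n) :
    (finRotate n i).val = if i.val + 1 = n then 0 else i.val + 1 := by
  obtain _ | n := n
  · exact i.elim0
  · rw [coe_finRotate]
    simp [Fin.ext_iff]

theorem finRotate_symm_val {n : ℕ} (i : Fin n) :
    ((finRotate n).symm i).val = if i.val = 0 then n - 1 else i.val - 1 := by
  have h := finRotate_val ((finRotate n).symm i)
  rw [Equiv.apply_symm_apply] at h
  have := ((finRotate n).symm i).isLt
  split_ifs at h ⊢ <;> omega

theorem phiStar_symm_val {n : ℕ} (σ : Fin n ≃ Fin n) (a : Fin n) :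
    ((phiStar σ).symm a).val = if (σ.symm a).val = 0 then n - 1 else (σ.symm a).val - 1 :=
  finRotate_symm_val _

theorem cycleGraph_adj_iff_finRotate {n : ℕ} {a b : Fin n} :
    (SimpleGraph.cycleGraph n).Adj a b ↔ a ≠ b ∧ (finRotate n a = b ∨ finRotate n b = a) := by
  obtain _ | n := n
  · exact a.elim0
  · obtain _ | n := n
    · obtain rfl : a = b := Fin.ext (by omega)
      simp
    · simp only [SimpleGraph.cycleGraph_adj, finRotate_apply, sub_eq_iff_eq_add]
      rw [add_comm 1 a, add_comm 1 b, eq_comm (a := b) (b := a + 1), or_comm]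
      refine ⟨fun h => ⟨?_, h.imp id Eq.symm⟩, fun h => h.2.imp id Eq.symm⟩
      rintro rfl
      simp at h

/-- Precomposition with an automorphism of `X`, as an automorphism of `FS(X, Y)`. -/
def FS.precompIso {V W : Type*} {X : SimpleGraph V} (Y : SimpleGraph W) (e : X ≃g X) :
    FS X Y ≃g FS X Y where
  toFun σ := e.toEquiv.trans σ
  invFun σ := e.toEquiv.symm.trans σ
  left_inv σ := Equiv.ext fun x => congrArg σ (e.apply_symm_apply x)
  right_inv σ := Equiv.ext fun x => congrArg σ (e.symm_apply_apply x)
  map_rel_iff' := by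
    intro σ τ
    constructor
    · rintro ⟨a, b, hX, hY, h1, h2, h3⟩
      refine ⟨e a, e b, e.map_adj_iff.2 hX, hY, h1, h2, fun c ha hb => ?_⟩
      obtain ⟨c, rfl⟩ := e.surjective c
      exact h3 c (fun h => ha (h ▸ rfl)) (fun h => hb (h ▸ rfl))
    · rintro ⟨a, b, hX, hY, h1, h2, h3⟩
      obtain ⟨a, rfl⟩ := e.surjective a
      obtain ⟨b, rfl⟩ := e.surjective b
      exact ⟨a, b, e.map_adj_iff.1 hX, hY, h1, h2, fun c ha hb =>
        h3 _ (fun h => ha (e.injective h)) (fun h => hb (e.injective h))⟩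

/-- The rotation, as an automorphism of the cycle graph. -/
def finRotateIso (n : ℕ) : SimpleGraph.cycleGraph n ≃g SimpleGraph.cycleGraph n where
  toEquiv := finRotate n
  map_rel_iff' := by
    intro a b
    simp only [cycleGraph_adj_iff_finRotate, ne_eq, (finRotate n).injective.eq_iff]

/-- The map `σ ↦ σ ∘ φ`, as an automorphism of `FS(Cycle_n, Y)`. -/
def phiStarIso {n : ℕ} (Y : SimpleGraph (Fin n)) :
    FS (SimpleGraph.cycleGraph n) Y ≃g FS (SimpleGraph.cycleGraph n) Y :=
  FS.precompIso Y (finRotateIso n)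

/-! ### Acyclic orientations, permutations and source flips. -/

namespace AcyclicOrientation

variable {V : Type*} {G : SimpleGraph V}

/-- The orientation of every edge towards its end with the larger label. -/
def ofLabel {ι : Type*} [LinearOrder ι] (f : V → ι) (hf : ∀ a b, G.Adj a b → f a ≠ f b) :
    AcyclicOrientation G where
  dir a b := G.Adj a b ∧ f a < f b
  adj_iff a b := by
    have h := hf a b
    have := G.adj_comm a b
    have := lt_or_lt_iff_ne (a := f a) (b := f b)
    tauto
  asymm a b h h' := h.2.asymm h'.2
  acyclic a h := by
    have key : ∀ b c, Relation.TransGen (fun a b => G.Adj a b ∧ f a < f b) b c → f b < f c := by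
      intro b c h
      induction h with
      | single h => exact h.2
      | tail _ h ih => exact ih.trans h.2
    exact (key a a h).false

/-- The orientation of every edge from the earlier to the later position. -/
def ofPerm (G : SimpleGraph V) {n : ℕ} (σ : Fin n ≃ V) : AcyclicOrientation G :=
  ofLabel σ.symm fun _ _ h => σ.symm.injective.ne h.ne

theorem ofPerm_dir {n : ℕ} (σ : Fin n ≃ V) {a b : V} :
    (ofPerm G σ).dir a b ↔ G.Adj a b ∧ σ.symm a < σ.symm b := Iff.rfl

theorem adj_of_dir (α : AcyclicOrientation G) {a b : V} (h : α.dir a b) : G.Adj a b :=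
  (α.adj_iff a b).2 (Or.inl h)

theorem eq_of_dir_imp {α β : AcyclicOrientation G} (h : ∀ a b, α.dir a b → β.dir a b) :
    α = β := by
  ext a b
  refine ⟨h a b, fun hb => ?_⟩
  rcases (α.adj_iff a b).1 (β.adj_of_dir hb) with ha | ha
  · exact ha
  · exact (β.asymm _ _ hb (h _ _ ha)).elim

theorem IsLinearExtension.eq_ofPerm {n : ℕ} {α : AcyclicOrientation G} {σ : Fin n ≃ V}
    (h : α.IsLinearExtension σ) : α = ofPerm G σ :=
  eq_of_dir_imp fun a b hab => ⟨α.adj_of_dir hab,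
    lt_of_le_of_ne (h a b (.single hab)) (σ.symm.injective.ne (α.adj_of_dir hab).ne)⟩

theorem exists_ofPerm_of_label {n : ℕ} {ι : Type*} [LinearOrder ι] (f : Fin n → ι) :
    ∃ σ : Fin n ≃ Fin n, ∀ a b, f a < f b → σ.symm a < σ.symm b := by
  refine ⟨Tuple.sort f, fun a b hab => lt_of_not_ge fun h => hab.not_ge ?_⟩
  simpa using Tuple.monotone_sort f h

/-- Counting strict ancestors works: an edge from `a` to `b` gives `b` all ancestors of `a` and also
`a` itself. -/
theorem exists_label [Finite V] (α : AcyclicOrientation G) :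
    ∃ f : V → ℕ, ∀ a b, α.dir a b → f a < f b := by
  refine ⟨fun a => {c | Relation.TransGen α.dir c a}.ncard, fun a b hab =>
    Set.ncard_lt_ncard ⟨fun c hc => hc.tail hab, fun h => ?_⟩ (Set.toFinite _)⟩
  exact α.acyclic a (h (.single hab))

theorem exists_eq_ofPerm {n : ℕ} {G : SimpleGraph (Fin n)} (α : AcyclicOrientation G) :
    ∃ σ : Fin n ≃ Fin n, ofPerm G σ = α := by
  obtain ⟨f, hf⟩ := α.exists_label
  obtain ⟨σ, hσ⟩ := exists_ofPerm_of_label f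
  exact ⟨σ, Eq.symm <| eq_of_dir_imp fun a b h => ⟨α.adj_of_dir h, hσ _ _ (hf _ _ h)⟩⟩

theorem exists_eq_ofPerm_of_isSource {n : ℕ} {G : SimpleGraph (Fin n)} (α : AcyclicOrientation G)
    {v : Fin n} (hv : α.IsSource v) :
    ∃ σ : Fin n ≃ Fin n, ofPerm G σ = α ∧ (σ.symm v).val = 0 := by
  obtain ⟨f, hf⟩ := α.exists_label
  -- The shift by 1 makes `v` the unique minimum, so sorting must put it first.
  obtain ⟨σ, hσ⟩ := exists_ofPerm_of_label fun a => if a = v then 0 else f a + 1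
  refine ⟨σ, Eq.symm <| eq_of_dir_imp fun a b h => ⟨α.adj_of_dir h, hσ _ _ ?_⟩, ?_⟩
  · have hb : b ≠ v := fun e => hv a (e ▸ h)
    have := hf _ _ h
    split_ifs <;> omega
  · by_contra h0
    have h := hσ v (σ ⟨0, by omega⟩)
    have hne : σ ⟨0, by omega⟩ ≠ v := fun e => h0 (by simp [← e])
    simp [hne, Fin.lt_def] at h

/-- The orientation `β` is obtained from `α` by turning the source `v` into a sink. -/
def IsSourceFlip (α β : AcyclicOrientation G) (v : V) : Prop :=
  α.IsSource v ∧ (∀ a b, (a = v ∨ b = v) → (β.dir a b ↔ α.dir b a)) ∧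
    (∀ a b, a ≠ v → b ≠ v → (β.dir a b ↔ α.dir a b))

theorem IsFlip.exists_isSourceFlip {α β : AcyclicOrientation G} (h : IsFlip α β) :
    ∃ v, IsSourceFlip α β v ∨ IsSourceFlip β α v := by
  obtain ⟨v, hv, h1, h2⟩ := h
  refine ⟨v, hv.imp (fun hv => ⟨hv, h1, h2⟩) fun hv => ⟨fun u hu => hv u ((h1 u v (.inr rfl)).1 hu),
    fun a b hab => (h1 b a hab.symm).symm, fun a b ha hb => (h2 a b ha hb).symm⟩⟩

theorem IsSourceFlip.isFlip {α β : AcyclicOrientation G} {v : V} (h : IsSourceFlip α β v) :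
    IsFlip α β :=
  ⟨v, Or.inl h.1, h.2⟩

theorem IsSourceFlip.eq {α β γ : AcyclicOrientation G} {v : V} (h : IsSourceFlip α β v)
    (h' : IsSourceFlip α γ v) : β = γ := by
  ext a b
  by_cases hab : a = v ∨ b = v
  · rw [h.2.1 a b hab, h'.2.1 a b hab]
  · push Not at hab
    rw [h.2.2 a b hab.1 hab.2, h'.2.2 a b hab.1 hab.2]

theorem isSourceFlip_ofPerm_phiStar {n : ℕ} {G : SimpleGraph (Fin n)} {σ : Fin n ≃ Fin n}
    {v : Fin n} (hv : (σ.symm v).val = 0) :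
    IsSourceFlip (ofPerm G σ) (ofPerm G (phiStar σ)) v := by
  have h0 : ∀ a, a ≠ v → (σ.symm a).val ≠ 0 := fun a ha h =>
    ha (σ.symm.injective (Fin.ext (h.trans hv.symm)))
  have hlt : ∀ a, (σ.symm a).val < n := fun a => (σ.symm a).isLt
  refine ⟨fun u hu => ?_, fun a b hab => ?_, fun a b ha hb => ?_⟩
  · have := hu.2
    rw [Fin.lt_def] at this
    omega
  · rw [ofPerm_dir, ofPerm_dir, G.adj_comm b a]
    refine and_congr_right fun hadj => ?_
    rw [Fin.lt_def, Fin.lt_def, phiStar_symm_val, phiStar_symm_val]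
    have ha := hlt a
    have hb := hlt b
    rcases hab with rfl | rfl
    · have := h0 b hadj.ne.symm
      rw [if_pos hv, if_neg this]; omega
    · have := h0 a hadj.ne
      rw [if_pos hv, if_neg this]; omega
  · rw [ofPerm_dir, ofPerm_dir]
    refine and_congr_right fun hadj => ?_
    rw [Fin.lt_def, Fin.lt_def, phiStar_symm_val, phiStar_symm_val, if_neg (h0 a ha),
      if_neg (h0 b hb)]
    have := h0 a ha
    have := h0 b hb
    omega

end AcyclicOrientation

open AcyclicOrientation

/-! ### Friendly swaps and the orientations they preserve. -/

section Cycle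

variable {n : ℕ} {Y : SimpleGraph (Fin n)}

/-- Only the swapped pair changes its relative order, and that pair is not an edge of the
complement. -/
theorem ofPerm_eq_of_swap_consecutive {σ τ : Fin n ≃ Fin n} {i j : Fin n}
    (hij : i.val + 1 = j.val) (hY : Y.Adj (σ i) (σ j)) (h1 : σ i = τ j) (h2 : σ j = τ i)
    (h3 : ∀ c, c ≠ i → c ≠ j → σ c = τ c) : ofPerm Yᶜ σ = ofPerm Yᶜ τ := by
  refine eq_of_dir_imp fun u v ⟨hadj, hlt⟩ => ⟨hadj, ?_⟩
  obtain ⟨a, rfl⟩ := σ.surjective u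
  obtain ⟨b, rfl⟩ := σ.surjective v
  have hτ : ∀ c, (c = i ∧ τ.symm (σ c) = j) ∨ (c = j ∧ τ.symm (σ c) = i) ∨
      (c ≠ i ∧ c ≠ j ∧ τ.symm (σ c) = c) := by
    intro c
    by_cases hi : c = i
    · exact .inl ⟨hi, by rw [hi, h1, Equiv.symm_apply_apply]⟩
    by_cases hj : c = j
    · exact .inr (.inl ⟨hj, by rw [hj, h2, Equiv.symm_apply_apply]⟩)
    · exact .inr (.inr ⟨hi, hj, by rw [h3 c hi hj, Equiv.symm_apply_apply]⟩)
  have hn : ¬ Y.Adj (σ a) (σ b) := hadj.2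
  simp only [Equiv.symm_apply_apply] at hlt
  rcases hτ a with ⟨rfl, ha⟩ | ⟨rfl, ha⟩ | ⟨ha1, ha2, ha⟩ <;>
  rcases hτ b with ⟨rfl, hb⟩ | ⟨rfl, hb⟩ | ⟨hb1, hb2, hb⟩ <;>
  first
  | exact (lt_irrefl _ hlt).elim
  | exact (hn hY).elim
  | rw [ha, hb]; simp only [Fin.lt_def, Fin.ext_iff, ne_eq] at *; omega

theorem ofPerm_eq_or_ofPerm_phiStar_eq_of_adj {σ τ : Fin n ≃ Fin n}
    (h : (FS (SimpleGraph.cycleGraph n) Y).Adj σ τ) :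
    ofPerm Yᶜ σ = ofPerm Yᶜ τ ∨ ofPerm Yᶜ (phiStar σ) = ofPerm Yᶜ (phiStar τ) := by
  have key : ∀ {σ τ : Fin n ≃ Fin n} {a b : Fin n}, finRotate n a = b → Y.Adj (σ a) (σ b) →
      σ a = τ b → σ b = τ a → (∀ c, c ≠ a → c ≠ b → σ c = τ c) → a ≠ b →
      ofPerm Yᶜ σ = ofPerm Yᶜ τ ∨ ofPerm Yᶜ (phiStar σ) = ofPerm Yᶜ (phiStar τ) := by
    intro σ τ a b hab hY h1 h2 h3 hne
    have hv := finRotate_val a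
    rw [hab] at hv
    split_ifs at hv with ha
    -- The swap crosses the seam. For n = 2 its edge also joins positions 0 and 1; otherwise
    -- rotation carries positions n-1, 0 to the consecutive positions n-2, n-1.
    · by_cases hn : n = 2
      · refine .inl (ofPerm_eq_of_swap_consecutive (i := b) (j := a) ?_ hY.symm h2 h1
          fun c hb ha => h3 c ha hb)
        omega
      · right
        obtain ⟨a, rfl⟩ := (finRotate n).surjective a
        obtain ⟨b, rfl⟩ := (finRotate n).surjective b
        refine ofPerm_eq_of_swap_consecutive (i := a) (j := b) ?_ hY h1 h2
          fun c hb ha => h3 _ (fun h => hb ((finRotate n).injective h))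
            fun h => ha ((finRotate n).injective h)
        have := finRotate_val a
        have := finRotate_val b
        have := Fin.val_ne_of_ne hne
        split_ifs at * <;> omega
    · exact .inl (ofPerm_eq_of_swap_consecutive hv.symm hY h1 h2 h3)
  obtain ⟨a, b, hX, hY, h1, h2, h3⟩ := h
  obtain ⟨hne, hab | hab⟩ := cycleGraph_adj_iff_finRotate.1 hX
  · exact key hab hY h1 h2 h3 hne
  · exact key hab hY.symm h2 h1 (fun c hb ha => h3 c ha hb) hne.symm

theorem exists_descent {f : Fin n ≃ Fin n} (hf : f ≠ Equiv.refl _) :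
    ∃ i j : Fin n, i.val + 1 = j.val ∧ f j < f i := by
  by_contra! h
  obtain _ | m := n
  · exact hf (Subsingleton.elim _ _)
  have hmono : StrictMono f := by
    rw [Fin.strictMono_iff_lt_succ]
    intro i
    exact lt_of_le_of_ne (h i.castSucc i.succ rfl) (f.injective.ne (Fin.castSucc_lt_succ).ne)
  refine hf (Equiv.ext fun i => ?_)
  have := Subsingleton.elim (hmono.orderIsoOfSurjective f f.surjective) (OrderIso.refl _)
  exact DFunLike.congr_fun this i

/-- Two linear extensions of the same orientation differ by friendly swaps. -/
theorem reachable_of_ofPerm_eq {σ τ : Fin n ≃ Fin n} (h : ofPerm Yᶜ σ = ofPerm Yᶜ τ) :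
    (FS (SimpleGraph.cycleGraph n) Y).Reachable σ τ := by
  obtain ⟨x, hx⟩ : ∃ x : Lex (Fin n → Fin n), x = toLex (τ.symm ∘ σ) := ⟨_, rfl⟩
  -- Bubble sort: undoing a descent of `τ⁻¹ ∘ σ` lowers it lexicographically. A descent is a pair on
  -- whose order `σ` and `τ` disagree, so it cannot be an edge of the complement.
  induction x using WellFoundedLT.induction generalizing σ with
  | ind x ih =>
    by_cases hστ : σ.trans τ.symm = Equiv.refl _
    · have : σ = τ := Equiv.ext fun i => by
        simpa using congrArg τ (DFunLike.congr_fun hστ i)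
      rw [this]
    obtain ⟨i, j, hij, hlt⟩ := exists_descent hστ
    have hne : i ≠ j := fun e => by simp [e] at hij
    have hltij : i < j := by rw [Fin.lt_def]; omega
    have hY : Y.Adj (σ i) (σ j) := by
      by_contra hn
      have : (ofPerm Yᶜ σ).dir (σ i) (σ j) :=
        ⟨⟨σ.injective.ne hne, hn⟩, by simpa using hltij⟩
      rw [h] at this
      exact this.2.asymm hlt
    have h1 : σ i = ((Equiv.swap i j).trans σ) j := by simp
    have h2 : σ j = ((Equiv.swap i j).trans σ) i := by simp
    have h3 : ∀ c, c ≠ i → c ≠ j → σ c = ((Equiv.swap i j).trans σ) c := fun c hi hj => by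
      simp [Equiv.swap_apply_of_ne_of_ne hi hj]
    have hadj : (FS (SimpleGraph.cycleGraph n) Y).Adj σ ((Equiv.swap i j).trans σ) := by
      refine ⟨i, j, cycleGraph_adj_iff_finRotate.2 ⟨hne, .inl (Fin.ext ?_)⟩, hY, h1, h2, h3⟩
      rw [finRotate_val, if_neg (by omega), hij]
    refine hadj.reachable.trans (ih _ ?_ ?_ rfl)
    · rw [hx]
      exact Pi.lex_desc (f := τ.symm ∘ σ) hltij.le hlt
    · rw [← h]
      exact (ofPerm_eq_of_swap_consecutive hij hY h1 h2 h3).symm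

/-- The connected component of `σ` in `FS(Cycle_n, Y)`. -/
abbrev FS.cycleComponent (Y : SimpleGraph (Fin n)) (σ : Fin n ≃ Fin n) :
    (FS (SimpleGraph.cycleGraph n) Y).ConnectedComponent :=
  (FS (SimpleGraph.cycleGraph n) Y).connectedComponentMk σ

/-- The permutation of the connected components of `FS(Cycle_n, Y)` induced by `σ ↦ σ ∘ φ`. -/
abbrev phiStarComponent (Y : SimpleGraph (Fin n)) :
    Equiv.Perm (FS (SimpleGraph.cycleGraph n) Y).ConnectedComponent :=
  (phiStarIso Y).connectedComponentEquiv

theorem phiStarComponent_cycleComponent (σ : Fin n ≃ Fin n) :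
    phiStarComponent Y (FS.cycleComponent Y σ) = FS.cycleComponent Y (phiStar σ) := rfl

theorem iterate_phiStarComponent_cycleComponent (σ : Fin n ≃ Fin n) (k : ℕ) :
    (phiStarComponent Y)^[k] (FS.cycleComponent Y σ) = FS.cycleComponent Y (phiStar^[k] σ) := by
  induction k generalizing σ with
  | zero => rfl
  | succ k ih => exact ih (phiStar σ)

theorem cycleComponent_eq_of_ofPerm_eq {σ τ : Fin n ≃ Fin n}
    (h : ofPerm Yᶜ σ = ofPerm Yᶜ τ) : FS.cycleComponent Y σ = FS.cycleComponent Y τ :=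
  SimpleGraph.ConnectedComponent.sound (reachable_of_ofPerm_eq h)

/-- Without leaving its component, `σ` can be replaced by a permutation with `v` in first position;
rotating that one performs the flip. -/
theorem cycleComponent_eq_of_isSourceFlip {σ τ : Fin n ≃ Fin n} {v : Fin n}
    (h : IsSourceFlip (ofPerm Yᶜ σ) (ofPerm Yᶜ τ) v) :
    FS.cycleComponent Y τ = phiStarComponent Y (FS.cycleComponent Y σ) := by
  obtain ⟨ρ, hρ, hv⟩ := exists_eq_ofPerm_of_isSource _ h.1
  have h' := isSourceFlip_ofPerm_phiStar (G := Yᶜ) hv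
  rw [hρ] at h'
  rw [cycleComponent_eq_of_ofPerm_eq hρ.symm, phiStarComponent_cycleComponent]
  exact cycleComponent_eq_of_ofPerm_eq (h.eq h')

theorem sameCycle_of_toricEquiv {σ τ : Fin n ≃ Fin n}
    (h : ToricEquiv (ofPerm Yᶜ σ) (ofPerm Yᶜ τ)) :
    (phiStarComponent Y).SameCycle (FS.cycleComponent Y σ) (FS.cycleComponent Y τ) := by
  obtain ⟨β, hβ⟩ : ∃ β, β = ofPerm Yᶜ τ := ⟨_, rfl⟩
  rw [← hβ] at h
  induction h generalizing τ with
  | refl => rw [cycleComponent_eq_of_ofPerm_eq hβ]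
  | @tail β γ _ hflip ih =>
    obtain ⟨ρ, hρ⟩ := exists_eq_ofPerm β
    refine (ih hρ.symm).trans ?_
    obtain ⟨v, hv | hv⟩ := hflip.exists_isSourceFlip
    · rw [← hρ, hβ] at hv
      rw [cycleComponent_eq_of_isSourceFlip hv]
      exact (Equiv.Perm.SameCycle.refl _ _).apply_right
    · rw [← hρ, hβ] at hv
      rw [cycleComponent_eq_of_isSourceFlip hv]
      exact (Equiv.Perm.SameCycle.refl _ _).apply_left

/-- The effect of moving every vertex of a union `S` of components of the complement once around the
circle. -/
theorem isPeriodicPt_ncard {S : Set (Fin n)} (hS : ∀ a b, Yᶜ.Adj a b → (a ∈ S ↔ b ∈ S))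
    (σ : Fin n ≃ Fin n) :
    Function.IsPeriodicPt (phiStarComponent Y) S.ncard (FS.cycleComponent Y σ) := by
  classical
  -- At time `t`, the members of `S` in the first `t` positions have gone once around. Labels of
  -- distinct vertices stay distinct modulo n.
  let f : ℕ → Fin n → ℕ := fun t a =>
    (σ.symm a).val + if a ∈ S ∧ (σ.symm a).val < t then n else 0
  have hf : ∀ t a b, Yᶜ.Adj a b → f t a ≠ f t b := by
    intro t a b hab h
    have := Fin.val_ne_of_ne (σ.symm.injective.ne hab.ne)
    have := (σ.symm a).isLt
    have := (σ.symm b).isLt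
    simp only [f] at h
    split_ifs at h <;> omega
  have hpos : ∀ a b, a ≠ b → (σ.symm a).val ≠ (σ.symm b).val := fun a b hab =>
    Fin.val_ne_of_ne (σ.symm.injective.ne hab)
  have key : ∀ t ≤ n, ∀ τ : Fin n ≃ Fin n, ofPerm Yᶜ τ = ofLabel (f t) (hf t) →
      FS.cycleComponent Y τ = (phiStarComponent Y)^[{a | a ∈ S ∧ (σ.symm a).val < t}.ncard]
        (FS.cycleComponent Y σ) := by
    intro t
    induction t with
    | zero =>
      intro _ τ hτ
      simp only [not_lt_zero, and_false, Set.ofPred_false, Set.ncard_empty, Function.iterate_zero, id]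
      refine cycleComponent_eq_of_ofPerm_eq (hτ.trans (eq_of_dir_imp fun a b h => ?_))
      simpa [ofLabel, ofPerm, f] using h
    | succ t ih =>
      intro ht τ hτ
      obtain ⟨ρ, hρ⟩ := exists_eq_ofPerm (ofLabel (f t) (hf t))
      have ih := ih (by omega) ρ hρ
      obtain ⟨v, hv⟩ : ∃ v, (σ.symm v).val = t := ⟨σ ⟨t, ht⟩, by simp⟩
      have hne : ∀ a, a ≠ v → (σ.symm a).val ≠ t := fun a ha => hv ▸ hpos a v ha
      have hstep : ∀ a, a ≠ v → f (t + 1) a = f t a := by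
        intro a ha
        have := hne a ha
        simp only [f]
        congr 2
        exact propext (and_congr_right fun _ => by omega)
      by_cases hvS : v ∈ S
      · have hset : {a | a ∈ S ∧ (σ.symm a).val < t + 1} =
            insert v {a | a ∈ S ∧ (σ.symm a).val < t} := by
          ext a
          by_cases ha : a = v
          · simp [ha, hvS, hv]
          · have := hne a ha
            simp only [Set.mem_insert_iff, Set.mem_ofPred_eq, ha, false_or]
            exact and_congr_right fun _ => by omega
        rw [hset, Set.ncard_insert_of_notMem (by simp [hv]), Function.iterate_succ_apply', ← ih]
        refine cycleComponent_eq_of_isSourceFlip (v := v) ?_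
        rw [hρ, hτ]
        have hfv : f t v = t := by simp [f, hv]
        have hfv' : f (t + 1) v = t + n := by simp [f, hv, hvS]
        -- Neighbours of `v` lie in `S`, so those before `v` have already been raised by n. Thus `v`
        -- is a source at label t and a sink at t + n.
        have hlarge : ∀ a, Yᶜ.Adj v a → t < f t a ∧ f t a < t + n := by
          intro a ha
          have haS := (hS v a ha).1 hvS
          have := hne a ha.ne.symm
          have := (σ.symm a).isLt
          simp only [f, haS, true_and]
          split_ifs <;> omega
        refine ⟨fun u hu => ?_, fun a b hab => ?_, fun a b ha hb => ?_⟩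
        · have h1 := hu.2
          have h2 := hlarge u hu.1.symm
          omega
        · change (Yᶜ.Adj a b ∧ _) ↔ (Yᶜ.Adj b a ∧ _)
          rw [Yᶜ.adj_comm b a]
          refine and_congr_right fun hadj => ?_
          rcases hab with rfl | rfl
          · have := hlarge b hadj
            rw [hfv, hfv', hstep b hadj.ne.symm]; omega
          · have := hlarge a hadj.symm
            rw [hfv, hfv', hstep a hadj.ne]; omega
        · change (Yᶜ.Adj a b ∧ _) ↔ (Yᶜ.Adj a b ∧ _)
          rw [hstep a ha, hstep b hb]
      · have hset : {a | a ∈ S ∧ (σ.symm a).val < t + 1} =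
            {a | a ∈ S ∧ (σ.symm a).val < t} := by
          ext a
          by_cases ha : a = v
          · simp [ha, hvS]
          · have := hne a ha
            exact and_congr_right fun _ => by omega
        rw [hset, ← ih]
        refine cycleComponent_eq_of_ofPerm_eq ?_
        have hfe : f (t + 1) = f t := by
          funext a
          by_cases ha : a = v
          · simp [f, ha, hvS]
          · exact hstep a ha
        rw [hτ, hρ]
        congr 1
  -- At time n all of `S` is raised by n; no edge leaves `S`, so the orientation is again that of
  -- `σ`.
  have h := key n le_rfl σ (eq_of_dir_imp fun a b h => ⟨h.1, ?_⟩)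
  · simp only [Fin.is_lt, and_true, Set.ofPred_mem_eq] at h
    exact h.symm
  · have := Fin.lt_def.1 h.2
    have hab := hS a b h.1
    simp only [f, hab]
    simpa using this

theorem isPeriodicPt_ncard_supp (C : Yᶜ.ConnectedComponent) (σ : Fin n ≃ Fin n) :
    Function.IsPeriodicPt (phiStarComponent Y) C.supp.ncard (FS.cycleComponent Y σ) :=
  isPeriodicPt_ncard (fun _ _ hab => SimpleGraph.ConnectedComponent.mem_supp_congr_adj C hab) σ

/-! ### From components to subgraphs. -/

theorem phiStarSubgraph_toSubgraph
    (c : (FS (SimpleGraph.cycleGraph n) Y).ConnectedComponent) :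
    phiStarSubgraph Y c.toSubgraph = (phiStarComponent Y c).toSubgraph := by
  unfold phiStarSubgraph
  congr 1
  ext σ
  induction c using SimpleGraph.ConnectedComponent.ind with
  | h τ =>
    simp only [SimpleGraph.Subgraph.induce_verts, Set.mem_image,
      SimpleGraph.ConnectedComponent.mem_supp_iff]
    rw [phiStarComponent_cycleComponent]
    constructor
    · rintro ⟨ρ, hρ, rfl⟩
      exact congrArg (phiStarComponent Y) hρ
    · intro h
      obtain ⟨ρ, rfl⟩ := (phiStarIso Y).surjective σ
      exact ⟨ρ, (phiStarComponent Y).injective h, rfl⟩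

theorem iterate_phiStarSubgraph_toSubgraph
    (c : (FS (SimpleGraph.cycleGraph n) Y).ConnectedComponent) (k : ℕ) :
    (phiStarSubgraph Y)^[k] c.toSubgraph = ((phiStarComponent Y)^[k] c).toSubgraph := by
  induction k generalizing c with
  | zero => rfl
  | succ k ih => rw [Function.iterate_succ_apply, phiStarSubgraph_toSubgraph, ih]; rfl

theorem toSubgraph_injective {V : Type*} {G : SimpleGraph V} :
    Function.Injective (SimpleGraph.ConnectedComponent.toSubgraph (G := G)) := fun _ _ h =>
  SimpleGraph.ConnectedComponent.supp_injective (congrArg SimpleGraph.Subgraph.verts h)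

theorem nonempty_iso_phiStarComponent
    (c : (FS (SimpleGraph.cycleGraph n) Y).ConnectedComponent) (k : ℕ) :
    Nonempty (c.toSubgraph.coe ≃g ((phiStarComponent Y)^[k] c).toSubgraph.coe) := by
  induction k generalizing c with
  | zero => exact ⟨SimpleGraph.Iso.refl⟩
  | succ k ih =>
    obtain ⟨e⟩ := ih (phiStarComponent Y c)
    have hsupp : ∀ σ, σ ∈ c.toSubgraph.verts ↔
        phiStarIso Y σ ∈ (phiStarComponent Y c).toSubgraph.verts := fun σ =>
      (phiStarComponent Y).injective.eq_iff.symm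
    let e' : c.toSubgraph.coe ≃g (phiStarComponent Y c).toSubgraph.coe :=
      { toEquiv := (phiStarIso Y).toEquiv.subtypeEquiv hsupp
        map_rel_iff' := by
          rintro ⟨σ, hσ⟩ ⟨τ, hτ⟩
          exact ⟨fun h => ⟨hσ, hτ, (phiStarIso Y).map_adj_iff.1 h.2.2⟩,
            fun h => ⟨(hsupp σ).1 hσ, (hsupp τ).1 hτ, (phiStarIso Y).map_adj_iff.2 h.2.2⟩⟩ }
    exact ⟨e'.trans e⟩

theorem isDisjointUnion_toSubgraph {V ι : Type*} {G : SimpleGraph V} (c : ι → G.ConnectedComponent)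
    (hc : Function.Bijective c) : IsDisjointUnion G fun i => (c i).toSubgraph := by
  refine ⟨fun i j hij => ?_, ?_⟩
  · exact SimpleGraph.pairwise_disjoint_supp_connectedComponent G (hc.1.ne hij)
  · ext u v
    · simp only [SimpleGraph.Subgraph.verts_iSup, Set.mem_iUnion, SimpleGraph.Subgraph.verts_top,
        Set.mem_univ, iff_true]
      obtain ⟨i, hi⟩ := hc.2 (G.connectedComponentMk u)
      exact ⟨i, hi.symm⟩
    · rw [SimpleGraph.Subgraph.iSup_adj]
      refine ⟨fun ⟨i, h⟩ => h.adj_sub, fun h => ?_⟩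
      obtain ⟨i, hi⟩ := hc.2 (G.connectedComponentMk u)
      exact ⟨i, hi.symm, (SimpleGraph.ConnectedComponent.sound h.symm.reachable).trans hi.symm, h⟩

end Cycle

/-! ### Winding numbers. -/

namespace AcyclicOrientation

variable {V : Type*} {G : SimpleGraph V} [Fintype V]

open Classical in
/-- `β` arises from `α` by moving every vertex `v` around the circle `c v` times, with total
winding number `k`. -/
def IsWinding (k : ℤ) (α β : AcyclicOrientation G) : Prop :=
  ∃ c : V → ℤ, ∑ v, c v = k ∧ ∀ u v, G.Adj u v →
    c u - c v = (if β.dir u v then 1 else 0) - (if α.dir u v then 1 else 0)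

theorem isWinding_refl (α : AcyclicOrientation G) : IsWinding 0 α α :=
  ⟨0, by simp, by simp⟩

theorem IsWinding.symm {k : ℤ} {α β : AcyclicOrientation G} (h : IsWinding k α β) :
    IsWinding (-k) β α := by
  obtain ⟨c, hc, h⟩ := h
  refine ⟨-c, by simp [hc], fun u v huv => ?_⟩
  have := h u v huv
  simp only [Pi.neg_apply]
  linarith

theorem IsWinding.trans {k l : ℤ} {α β γ : AcyclicOrientation G} (h : IsWinding k α β)
    (h' : IsWinding l β γ) : IsWinding (k + l) α γ := by
  obtain ⟨c, hc, h⟩ := h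
  obtain ⟨d, hd, h'⟩ := h'
  refine ⟨c + d, by simp [Finset.sum_add_distrib, hc, hd], fun u v huv => ?_⟩
  have := h u v huv
  have := h' u v huv
  simp only [Pi.add_apply]
  linarith

theorem IsSourceFlip.isWinding {α β : AcyclicOrientation G} {v : V} (h : IsSourceFlip α β v) :
    IsWinding (-1) α β := by
  classical
  refine ⟨fun a => if a = v then -1 else 0, by simp, fun a b hab => ?_⟩
  have hd := (α.adj_iff a b).1 hab
  have hs := h.1
  by_cases ha : a = v
  · subst ha
    rw [h.2.1 a b (.inl rfl)]
    have hn := hs b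
    have := hd.resolve_right hn
    simp [hab.ne.symm, hn, this]
  by_cases hb : b = v
  · subst hb
    rw [h.2.1 a b (.inr rfl)]
    have hn := hs a
    have := hd.resolve_left hn
    simp [ha, hn, this]
  · simp [ha, hb, h.2.2 a b ha hb]

/-- With equal ends, `c` is constant along edges, so each component contributes its size times an
integer. -/
theorem IsWinding.componentGcd_dvd {k : ℤ} {α : AcyclicOrientation G} (h : IsWinding k α α) :
    (componentGcd G : ℤ) ∣ k := by
  classical
  obtain ⟨c, rfl, h⟩ := h
  have hadj : ∀ u v, G.Adj u v → c u = c v := fun u v huv => by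
    have := h u v huv
    linarith
  have hreach : ∀ u v, G.Reachable u v → c u = c v := by
    rintro u v ⟨p⟩
    induction p with
    | nil => rfl
    | cons huv _ ih => exact (hadj _ _ huv).trans ih
  let _ : Fintype G.ConnectedComponent := Fintype.ofFinite _
  rw [← Finset.sum_fiberwise Finset.univ G.connectedComponentMk c]
  refine Finset.dvd_sum fun C _ => ?_
  induction C using SimpleGraph.ConnectedComponent.ind with
  | h v =>
    rw [Finset.sum_congr rfl (g := fun _ => c v) fun u hu =>
      hreach u v (SimpleGraph.ConnectedComponent.exact (Finset.mem_filter.1 hu).2),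
      Finset.sum_const, nsmul_eq_mul]
    refine Dvd.dvd.mul_right (Int.natCast_dvd_natCast.2 ?_) _
    have hcard : (Finset.univ.filter fun u => G.connectedComponentMk u =
        G.connectedComponentMk v).card = (G.connectedComponentMk v).supp.ncard := by
      rw [← Set.ncard_coe_finset]
      congr 1
      ext u
      simp [SimpleGraph.ConnectedComponent.mem_supp_iff]
    rw [hcard]
    exact Finset.gcd_dvd (f := fun c : G.ConnectedComponent => c.supp.ncard) (Finset.mem_univ _)

end AcyclicOrientation

/-! ### Orbit lengths and the classification of components. -/

section NonemptyCycle

variable {n : ℕ} [NeZero n] {Y : SimpleGraph (Fin n)}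

theorem exists_isSourceFlip_phiStar (G : SimpleGraph (Fin n)) (σ : Fin n ≃ Fin n) :
    ∃ v, IsSourceFlip (ofPerm G σ) (ofPerm G (phiStar σ)) v :=
  ⟨σ 0, isSourceFlip_ofPerm_phiStar (by simp)⟩

theorem isWinding_phiStar_iterate (G : SimpleGraph (Fin n)) (σ : Fin n ≃ Fin n) (k : ℕ) :
    IsWinding (-k) (ofPerm G σ) (ofPerm G (phiStar^[k] σ)) := by
  induction k with
  | zero => simpa using isWinding_refl _
  | succ k ih =>
    obtain ⟨v, hv⟩ := exists_isSourceFlip_phiStar G (phiStar^[k] σ)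
    rw [Function.iterate_succ_apply']
    have := ih.trans hv.isWinding
    rwa [show -(k : ℤ) + -1 = -((k + 1 : ℕ) : ℤ) by push_cast; ring] at this

/-- A swap across the seam amounts to a source flip followed by the inverse of another, so the
windings -1 and 1 cancel. -/
theorem isWinding_of_reachable {σ τ : Fin n ≃ Fin n}
    (h : (FS (SimpleGraph.cycleGraph n) Y).Reachable σ τ) :
    IsWinding 0 (ofPerm Yᶜ σ) (ofPerm Yᶜ τ) := by
  obtain ⟨p⟩ := h
  induction p with
  | nil => exact isWinding_refl _
  | @cons σ τ _ hadj _ ih =>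
    refine IsWinding.trans (k := 0) (l := 0) ?_ ih
    rcases ofPerm_eq_or_ofPerm_phiStar_eq_of_adj hadj with h | h
    · rw [h]; exact isWinding_refl _
    · obtain ⟨v, hv⟩ := exists_isSourceFlip_phiStar Yᶜ σ
      obtain ⟨w, hw⟩ := exists_isSourceFlip_phiStar Yᶜ τ
      rw [h] at hv
      exact hv.isWinding.trans hw.isWinding.symm

theorem toricEquiv_of_reachable {σ τ : Fin n ≃ Fin n}
    (h : (FS (SimpleGraph.cycleGraph n) Y).Reachable σ τ) :
    ToricEquiv (ofPerm Yᶜ σ) (ofPerm Yᶜ τ) := by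
  obtain ⟨p⟩ := h
  induction p with
  | nil => exact toricEquiv_equivalence.refl _
  | @cons σ τ _ hadj _ ih =>
    refine toricEquiv_equivalence.trans ?_ ih
    rcases ofPerm_eq_or_ofPerm_phiStar_eq_of_adj hadj with h | h
    · rw [h]; exact toricEquiv_equivalence.refl _
    · obtain ⟨v, hv⟩ := exists_isSourceFlip_phiStar Yᶜ σ
      obtain ⟨w, hw⟩ := exists_isSourceFlip_phiStar Yᶜ τ
      rw [h] at hv
      exact .head hv.isFlip (.single hw.isFlip.symm)

theorem toricEquiv_phiStar_iterate (G : SimpleGraph (Fin n)) (σ : Fin n ≃ Fin n) (k : ℕ) :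
    ToricEquiv (ofPerm G σ) (ofPerm G (phiStar^[k] σ)) := by
  induction k with
  | zero => exact toricEquiv_equivalence.refl _
  | succ k ih =>
    obtain ⟨v, hv⟩ := exists_isSourceFlip_phiStar G (phiStar^[k] σ)
    rw [Function.iterate_succ_apply']
    exact ih.tail hv.isFlip

/-- The rotation permutes the components over a toric acyclic orientation with period `ν`. -/
theorem minimalPeriod_phiStarComponent (σ : Fin n ≃ Fin n) :
    Function.minimalPeriod (phiStarComponent Y) (FS.cycleComponent Y σ) = componentGcd Yᶜ := by
  refine Nat.dvd_antisymm ?_ ?_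
  · exact Finset.dvd_gcd fun C _ => (isPeriodicPt_ncard_supp C σ).minimalPeriod_dvd
  · have h := Function.iterate_minimalPeriod (f := phiStarComponent Y) (x := FS.cycleComponent Y σ)
    rw [iterate_phiStarComponent_cycleComponent] at h
    -- Rotating through one minimal period and returning by swaps closes up, with total winding
    -- minus that period.
    have hw := (isWinding_phiStar_iterate Yᶜ σ _).trans
      (isWinding_of_reachable (SimpleGraph.ConnectedComponent.exact h))
    have := hw.componentGcd_dvd
    rw [add_zero, dvd_neg] at this
    exact Int.natCast_dvd_natCast.1 this

theorem componentGcd_pos (Y : SimpleGraph (Fin n)) : 0 < componentGcd Yᶜ := by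
  rw [← minimalPeriod_phiStarComponent (Y := Y) (Equiv.refl _)]
  refine (isPeriodicPt_ncard_supp (Yᶜ.connectedComponentMk 0) _).minimalPeriod_pos ?_
  rw [Set.ncard_pos]
  exact SimpleGraph.ConnectedComponent.nonempty_supp _

/-- Swaps and rotations preserve the toric class, which recovers `t`; the minimal period separates
the exponents. Surjectivity holds because toric equivalence keeps components in one φ*-orbit. -/
theorem bijective_component {ν : ℕ} (hν : ν = componentGcd Yᶜ)
    (σ : ToricAcyclicOrientation Yᶜ → (Fin n ≃ Fin n))
    (hσ : ∀ t, t = Quotient.mk (toricSetoid Yᶜ) (ofPerm Yᶜ (σ t))) :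
    Function.Bijective fun p : ToricAcyclicOrientation Yᶜ × Fin ν =>
      (phiStarComponent Y)^[p.2] (FS.cycleComponent Y (σ p.1)) := by
  have hper := fun τ => (minimalPeriod_phiStarComponent (Y := Y) τ).trans hν.symm
  constructor
  · rintro ⟨t, k⟩ ⟨s, l⟩ h
    dsimp only at h
    have hts : t = s := by
      rw [iterate_phiStarComponent_cycleComponent, iterate_phiStarComponent_cycleComponent] at h
      rw [hσ t, hσ s]
      refine Quotient.sound ?_
      exact toricEquiv_equivalence.trans (toricEquiv_phiStar_iterate Yᶜ (σ t) k)
        (toricEquiv_equivalence.trans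
          (toricEquiv_of_reachable (SimpleGraph.ConnectedComponent.exact h))
          (toricEquiv_equivalence.symm (toricEquiv_phiStar_iterate Yᶜ (σ s) l)))
    subst hts
    have hk : k.val = l.val :=
      (Function.iterate_eq_iterate_iff_of_lt_minimalPeriod (by rw [hper]; exact k.isLt)
        (by rw [hper]; exact l.isLt)).1 h
    rw [Fin.ext hk]
  · intro c
    induction c using SimpleGraph.ConnectedComponent.ind with
    | h τ =>
      let t : ToricAcyclicOrientation Yᶜ := Quotient.mk (toricSetoid Yᶜ) (ofPerm Yᶜ τ)
      have ht : ToricEquiv (ofPerm Yᶜ (σ t)) (ofPerm Yᶜ τ) :=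
        Quotient.exact (s := toricSetoid Yᶜ) (hσ t).symm
      obtain ⟨k, hk⟩ := (sameCycle_of_toricEquiv ht).exists_nat_pow_eq
      refine ⟨⟨t, ⟨k % ν, Nat.mod_lt _ (hν ▸ componentGcd_pos Y)⟩⟩, ?_⟩
      have h := Function.iterate_mod_minimalPeriod_eq (f := phiStarComponent Y)
        (x := FS.cycleComponent Y (σ t)) (n := k)
      rw [hper] at h
      rw [Equiv.Perm.coe_pow] at hk
      exact h.trans hk

end NonemptyCycle

theorem theorem4p6 (n : ℕ) (hn : 1 ≤ n) (Y : SimpleGraph (Fin n))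
    (σ : ToricAcyclicOrientation Yᶜ → (Fin n ≃ Fin n))
    (hσ : ∀ t : ToricAcyclicOrientation Yᶜ, t.IsLinearExtension (σ t)) :
    let F := FS (SimpleGraph.cycleGraph n) Y
    let ν := componentGcd Yᶜ
    let J : ToricAcyclicOrientation Yᶜ → ℕ → F.Subgraph :=
      fun t k => (phiStarSubgraph Y)^[k] (componentAt F (σ t))
    (∀ t, ∀ k < ν, ∃ c : F.ConnectedComponent, J t k = c.toSubgraph) ∧
    (∀ t, ∀ k < ν, ∀ l < ν, k ≠ l → J t k ≠ J t l) ∧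
    (∀ t, ∀ k < ν, ∀ l < ν, Nonempty ((J t k).coe ≃g (J t l).coe)) ∧
    IsDisjointUnion F (fun p : ToricAcyclicOrientation Yᶜ × Fin ν => J p.1 p.2) := by
  intro F ν J
  have : NeZero n := ⟨by omega⟩
  have hJ : ∀ t k, J t k = ((phiStarComponent Y)^[k] (FS.cycleComponent Y (σ t))).toSubgraph :=
    fun t k => iterate_phiStarSubgraph_toSubgraph _ k
  have hbij := bijective_component (ν := ν) rfl σ fun t => by
    obtain ⟨α, hα, hlin⟩ := hσ t
    rw [← hlin.eq_ofPerm, hα]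
  refine ⟨fun t k _ => ⟨_, hJ t k⟩, fun t k hk l hl hkl h => ?_, fun t k _ l _ => ?_, ?_⟩
  · rw [hJ, hJ] at h
    have := @hbij.1 (t, ⟨k, hk⟩) (t, ⟨l, hl⟩) (toSubgraph_injective h)
    simp only [Prod.mk.injEq, Fin.mk.injEq, true_and] at this
    exact hkl this
  · rw [hJ, hJ]
    obtain ⟨e⟩ := nonempty_iso_phiStarComponent (FS.cycleComponent Y (σ t)) k
    obtain ⟨e'⟩ := nonempty_iso_phiStarComponent (FS.cycleComponent Y (σ t)) l
    exact ⟨e.symm.trans e'⟩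
  · simp only [hJ]
    exact isDisjointUnion_toSubgraph _ hbij
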